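/- Let $\mathbb{X}$ be a Polish space with its Borel $\sigma$-algebra $\mathcal B$. Let $\delta:\mathbb{N}=\{0,1,2,\dots\}\to[0,1]$ be non-increasing with $\delta(0)=1$, $\delta(1)<1$, $\lim_{t\to\infty}\delta(t)=0$, and log sub-additive, i.e. $\delta(t+s)\ge\delta(t)\delta(s)$ for all $s,t\in\mathbb{N}$. For a transition (probability) kernel $Q$ on $\mathbb{X}$, let $\mathbb{E}^Q_x$ be the expectation under which $X=(X_t)_{t\in\mathbb{N}}$ is the time-homogeneous Markov chain with kernel $Q$ and $X_0=x$. For $S\in\mathcal B$ put $\rho(S):=\inf\{t\ge 1: X_t\in S\}$ (with $\inf\emptyset=\infty$). For a bounded Borel function $f:\mathbb{X}\to[0,\infty)$ (a reward function) put $$J^Q(x,S,f):=\begin{cases} f(x), & x\in S,\\ \mathbb{E}^Q_x[\delta(\rho(S))f(X_{\rho(S)})], & x\notin S,\end{cases}$$ where $\delta(\rho(S))f(X_{\rho(S)}):=0$ on $\{\rho(S)=\infty\}$. A set $S\in\mathcal B$ is an equilibrium for $(f,Q)$ if $f(x)\le\mathbb{E}^Q_x[\delta(\rho(S))f(X_{\rho(S)})]$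 for all $x\notin S$ and $f(x)\ge\mathbb{E}^Q_x[\delta(\rho(S))f(X_{\rho(S)})]$ for all $x\in S$. Let $\mathcal E^Q(f)$ be the set of all equilibria, let $S^*(f,Q):=\bigcap_{S\in\mathcal E^Q(f)}S$ (the smallest optimal equilibrium), and let $V^Q(x,f):=\sup_{S\in\mathcal E^Q(f)}J^Q(x,S,f)$ (the optimal equilibrium value). Let $Q^n$ $(n\in\mathbb{N}\cup\{\infty\})$ be transition kernels and $f^n$ $(n\in\mathbb{N}\cup\{\infty\})$ nonnegative Borel reward functions on $\mathbb{X}$ with $\sup_{n\in\mathbb{N}\cup\{\infty\}}\|f^n\|_\infty<\infty$. Suppose that for every compact $K\subset\mathbb{X}$ $$\lim_{n\to\infty}\sup_{x\in K}\|Q^n(x,\cdot)-Q^\infty(x,\cdot)\|_{\mathrm{TV}}=0\quad\text{and}\quad\lim_{n\to\infty}\sup_{x\in K}|f^n(x)-f^\infty(x)|=0,$$ where $\|\mu-\nu\|_{\mathrm{TV}}:=\sup_g\left(\int g\,d\mu-\int g\,d\nu\right)$ over all Borel functions $g:\mathbb{X}\to[-1,1]$. Then $$S^*(f^\infty,Q^\infty)\subset\liminf_{n\to\infty}S^*(f^n,Q^n):=\bigcup_{n\in\mathbb{N}}\bigcap_{m\ge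 n}S^*(f^m,Q^m),$$ and $$V^{Q^\infty}(x,f^\infty)\ge\limsup_{n\to\infty}V^{Q^n}(x,f^n)\quad\text{for all }x\in\mathbb{X}.$$ -/

import Mathlib

open MeasureTheory ProbabilityTheory Filter Topology

noncomputable section

namespace EquilibriumStopping

variable {X : Type*} [MeasurableSpace X]

/-- The law on path space `ℕ → X` of the time-homogeneous Markov chain with transition kernel `Q`
started from `x` (Ionescu-Tulcea): given the path up to time `n`, the state at time `n + 1` has
law `Q (ω n)`. The chain itself is the coordinate process `(t, ω) ↦ ω t`. -/
def pathLaw (Q : Kernel X X) [IsMarkovKernel Q] (x : X) : Measure (ℕ → X) :=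
  Kernel.traj (X := fun _ : ℕ => X)
    (fun n : ℕ =>
      Q.comap (fun p : (Finset.Iic n → X) => p ⟨n, Finset.mem_Iic.2 le_rfl⟩)
        (measurable_pi_apply _))
    0 (fun _ => x)

/-- The first time `t ≥ 1` at which the path is in `S`, with value `⊤` if there is none. -/
def rho (S : Set X) : (ℕ → X) → WithTop ℕ :=
  hittingAfter (fun (t : ℕ) (ω : ℕ → X) => ω t) S 1

/-- The discounted reward `δ(τ) f(X_τ)` along a path, which is `0` where `τ = ⊤`. -/
def discountedReward (δ : ℕ → ℝ) (f : X → ℝ) (τ : (ℕ → X) → WithTop ℕ) (ω : ℕ → X) : ℝ :=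
  match τ ω with
  | ⊤ => 0
  | (t : ℕ) => δ t * f (ω t)

/-- The expected discounted reward of stopping at `τ`, for the chain started from `x`. -/
def stopValue (δ : ℕ → ℝ) (Q : Kernel X X) [IsMarkovKernel Q] (x : X)
    (τ : (ℕ → X) → WithTop ℕ) (f : X → ℝ) : ℝ :=
  ∫ ω, discountedReward δ f τ ω ∂(pathLaw Q x)

open Classical in
/-- The value at `x` of the stopping policy with stopping region `S`. -/
def policyValue (δ : ℕ → ℝ) (Q : Kernel X X) [IsMarkovKernel Q] (x : X)
    (S : Set X) (f : X → ℝ) : ℝ :=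
  if x ∈ S then f x else stopValue δ Q x (rho S) f

/-- `S` is a (Borel) equilibrium for the reward `f` and the transition kernel `Q`. -/
def IsEquilibrium (δ : ℕ → ℝ) (Q : Kernel X X) [IsMarkovKernel Q] (f : X → ℝ)
    (S : Set X) : Prop :=
  MeasurableSet S ∧
    (∀ x, x ∉ S → f x ≤ stopValue δ Q x (rho S) f) ∧
    (∀ x, x ∈ S → stopValue δ Q x (rho S) f ≤ f x)

/-- The smallest optimal equilibrium: the intersection of all equilibria. -/
def smallestEquilibrium (δ : ℕ → ℝ) (f : X → ℝ) (Q : Kernel X X) [IsMarkovKernel Q] : Set X :=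
  ⋂₀ {S : Set X | IsEquilibrium δ Q f S}

/-- The optimal equilibrium value: the supremum over all equilibria of the policy value, taken in
the extended reals. -/
def optimalValue (δ : ℕ → ℝ) (Q : Kernel X X) [IsMarkovKernel Q] (x : X) (f : X → ℝ) : EReal :=
  ⨆ (S : Set X) (_ : IsEquilibrium δ Q f S), (policyValue δ Q x S f : EReal)

/-- The total variation distance: the supremum of `∫ g dμ - ∫ g dν` over measurable functions `g`
with values in `[-1, 1]`. It is nonnegative because `g = 0` is allowed. -/
def tvDist (μ ν : Measure X) : ENNReal :=
  ⨆ (g : X → ℝ) (_ : Measurable g ∧ ∀ y, g y ∈ Set.Icc (-1 : ℝ) 1),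
    ENNReal.ofReal (∫ y, g y ∂μ - ∫ y, g y ∂ν)

/-- Locally uniform convergence of kernels in total variation: uniform on each compact set. -/
def TendstoLocallyUniformlyTV [TopologicalSpace X] (Q : ℕ → Kernel X X) (Qlim : Kernel X X) :
    Prop :=
  ∀ K : Set X, IsCompact K →
    Tendsto (fun n => ⨆ x ∈ K, tvDist (Q n x) (Qlim x)) atTop (𝓝 0)

end EquilibriumStopping

end

/-! For a set `S`, compare the value of waiting for `S` (`entryValue`) with that of stopping
optimally no later than the entry of `S` (`snellValue`). The latter decreases as `S` grows and
dominates the stopping value of every larger set. Log sub-additivity of `δ` gives a converse: if off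
`S` the Snell continuation value is at least `f`, then waiting for `S` is optimal
(`snellValue_eq_entryValue`). Hence the stopping value of an equilibrium is its Snell continuation
value.

Start from `∅` and add the states where `f` strictly exceeds the Snell continuation value of the
current set. Every equilibrium contains all these iterates, and their union is an equilibrium, so
the union is the smallest one (`smallestEquilibrium_eq`); monotonicity makes it optimal.

The limit theorem rests on upper semicontinuity (`eventually_integral_snellValue_lt`): if each point
of `T` is eventually in `S n`, the Snell continuation values for `S n`, `f n`, `Q n` are eventually
below any number above the one for `T` and the limit data. The strict inequality defining an iterate
therefore survives the perturbation, and induction over the iterates gives the inclusion. With the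
inclusion, the same semicontinuity bounds the values. -/

namespace EquilibriumStopping

/-! ### Bounded rewards, discounted families and their comparison principle -/

section Families

variable {X : Type*} [MeasurableSpace X] {δ : ℕ → ℝ} {M : ℝ}

/-- A discount function: decreasing to `0` with values in `[0, 1]` and log sub-additive. -/
structure IsDiscount (δ : ℕ → ℝ) : Prop where
  nonneg : ∀ t, 0 ≤ δ t
  le_one : ∀ t, δ t ≤ 1
  anti : Antitone δ
  tendsto : Tendsto δ atTop (𝓝 0)
  mul_le : ∀ s t, δ t * δ s ≤ δ (t + s)

/-- A measurable reward function with values in `[0, M]`. -/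
structure IsReward (M : ℝ) (f : X → ℝ) : Prop where
  measurable : Measurable f
  nonneg : ∀ x, 0 ≤ f x
  le : ∀ x, f x ≤ M

/-- A time-dependent measurable function between `0` and `M * δ`. -/
structure IsDiscountedFamily (δ : ℕ → ℝ) (M : ℝ) (a : ℕ → X → ℝ) : Prop where
  measurable : ∀ m, Measurable (a m)
  nonneg : ∀ m y, 0 ≤ a m y
  le : ∀ m y, a m y ≤ M * δ m

lemma IsReward.zero (hM : 0 ≤ M) : IsReward M (fun _ : X => (0 : ℝ)) :=
  ⟨measurable_const, fun _ => le_rfl, fun _ => hM⟩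

lemma IsReward.integrable {f : X → ℝ} (hf : IsReward M f) (μ : Measure X) [IsFiniteMeasure μ] :
    Integrable f μ :=
  Integrable.of_bound hf.measurable.aestronglyMeasurable M
    (ae_of_all _ fun x => by rw [Real.norm_of_nonneg (hf.nonneg x)]; exact hf.le x)

lemma IsReward.integral_nonneg {f : X → ℝ} (hf : IsReward M f) (μ : Measure X) :
    0 ≤ ∫ x, f x ∂μ :=
  MeasureTheory.integral_nonneg hf.nonneg

lemma IsReward.integral_le {f : X → ℝ} (hf : IsReward M f) (μ : Measure X)
    [IsProbabilityMeasure μ] : ∫ x, f x ∂μ ≤ M := by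
  calc ∫ x, f x ∂μ ≤ ∫ _, M ∂μ := integral_mono (hf.integrable μ) (integrable_const _) hf.le
    _ = M := by simp

lemma IsReward.measurable_integral {Y : Type*} [MeasurableSpace Y] {f : X → ℝ}
    (hf : IsReward M f) (Q : Kernel Y X) :
    Measurable fun x => ∫ y, f y ∂Q x :=
  (hf.measurable.stronglyMeasurable.integral_kernel (κ := Q)).measurable

lemma IsDiscountedFamily.isReward {a : ℕ → X → ℝ} (ha : IsDiscountedFamily δ M a) (m : ℕ) :
    IsReward (M * δ m) (a m) :=
  ⟨ha.measurable m, ha.nonneg m, ha.le m⟩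

lemma IsDiscountedFamily.isReward_bound {a : ℕ → X → ℝ} (ha : IsDiscountedFamily δ M a)
    (hδ : IsDiscount δ) (hM : 0 ≤ M) (m : ℕ) : IsReward M (a m) :=
  ⟨ha.measurable m, ha.nonneg m, fun y =>
    (ha.le m y).trans (mul_le_of_le_one_right hM (hδ.le_one m))⟩

/-- The comparison principle for discounted families. -/
lemma IsDiscountedFamily.le_of_step (hδ : IsDiscount δ)
    {Q : Kernel X X} [IsMarkovKernel Q] {a b : ℕ → X → ℝ}
    (ha : IsDiscountedFamily δ M a) (hb : IsDiscountedFamily δ M b)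
    (hstep : ∀ m y, a m y ≤ b m y ∨
      a m y - b m y ≤ ∫ z, a (m + 1) z ∂Q y - ∫ z, b (m + 1) z ∂Q y) (m : ℕ) (y : X) :
    a m y ≤ b m y := by
  have hnn : ∀ m, 0 ≤ M * δ m := fun m => (ha.nonneg m y).trans (ha.le m y)
  -- A positive excess of `a` over `b` is passed on to the next time; after `N` steps it is at most
  -- `M * δ (m + N)`, which vanishes.
  have key : ∀ N m y, a m y - b m y ≤ M * δ (m + N) := by
    intro N
    induction N with
    | zero => intro m y; rw [add_zero]; linarith [ha.le m y, hb.nonneg m y]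
    | succ N ih =>
      intro m y
      rcases hstep m y with h | h
      · linarith [hnn (m + (N + 1))]
      · refine h.trans ?_
        have ia := (ha.isReward (m + 1)).integrable (Q y)
        have ib := (hb.isReward (m + 1)).integrable (Q y)
        rw [← integral_sub ia ib]
        calc ∫ z, (a (m + 1) z - b (m + 1) z) ∂Q y ≤ ∫ _, M * δ (m + (N + 1)) ∂Q y := by
              refine integral_mono (ia.sub ib) (integrable_const _) fun z => ?_
              have := ih (m + 1) z
              rwa [show m + 1 + N = m + (N + 1) by ring] at this
          _ = _ := by simp
  have hlim : Tendsto (fun N => M * δ (m + N)) atTop (𝓝 0) := by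
    simpa using ((hδ.tendsto.comp (tendsto_add_atTop_nat m)).const_mul M).congr
      fun N => by simp [add_comm]
  linarith [ge_of_tendsto' hlim fun N => key N m y]

end Families

/-! ### Backward induction with forced stopping on a set -/

section Value

variable {X : Type*} [MeasurableSpace X] {δ : ℕ → ℝ} {M : ℝ}

open Classical in
/-- The value, at time `m` and state `y` and with `N` steps to go, of a stopping problem in which
one is forced to stop with reward `f` on `S`, may stop with reward `h` off `S`, and gets nothing
when the steps run out. -/
noncomputable def truncValue (δ : ℕ → ℝ) (Q : Kernel X X) (f h : X → ℝ) (S : Set X) :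
    ℕ → ℕ → X → ℝ
  | 0, _, _ => 0
  | N + 1, m, y =>
    if y ∈ S then δ m * f y else max (δ m * h y) (∫ z, truncValue δ Q f h S N (m + 1) z ∂Q y)

/-- The infinite-horizon limit of `truncValue`. -/
noncomputable def bellmanValue (δ : ℕ → ℝ) (Q : Kernel X X) (f h : X → ℝ) (S : Set X)
    (m : ℕ) (y : X) : ℝ :=
  ⨆ N, truncValue δ Q f h S N m y

variable {Q : Kernel X X} {f h : X → ℝ} {S : Set X}

lemma truncValue_succ_of_mem {y : X} (hy : y ∈ S) (N m : ℕ) :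
    truncValue δ Q f h S (N + 1) m y = δ m * f y := by
  simp [truncValue, hy]

lemma truncValue_succ_of_notMem {y : X} (hy : y ∉ S) (N m : ℕ) :
    truncValue δ Q f h S (N + 1) m y =
      max (δ m * h y) (∫ z, truncValue δ Q f h S N (m + 1) z ∂Q y) := by
  simp [truncValue, hy]

lemma truncValue_isDiscountedFamily [IsMarkovKernel Q] (hδ : IsDiscount δ) (hM : 0 ≤ M)
    (hf : IsReward M f) (hh : IsReward M h) (hS : MeasurableSet S) (N : ℕ) :
    IsDiscountedFamily δ M (truncValue δ Q f h S N) := by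
  induction N with
  | zero =>
    exact ⟨fun m => measurable_const, fun m y => le_rfl, fun m y => mul_nonneg hM (hδ.nonneg m)⟩
  | succ N ih =>
    refine ⟨fun m => ?_, fun m y => ?_, fun m y => ?_⟩
    · exact Measurable.ite hS (hf.measurable.const_mul _)
        ((hh.measurable.const_mul _).max ((ih.isReward (m + 1)).measurable_integral Q))
    · by_cases hy : y ∈ S
      · rw [truncValue_succ_of_mem hy]
        exact mul_nonneg (hδ.nonneg m) (hf.nonneg y)
      · rw [truncValue_succ_of_notMem hy]
        exact le_max_of_le_left (mul_nonneg (hδ.nonneg m) (hh.nonneg y))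
    · by_cases hy : y ∈ S
      · rw [truncValue_succ_of_mem hy, mul_comm]
        exact mul_le_mul_of_nonneg_right (hf.le y) (hδ.nonneg m)
      · rw [truncValue_succ_of_notMem hy]
        refine max_le ?_ ?_
        · rw [mul_comm]
          exact mul_le_mul_of_nonneg_right (hh.le y) (hδ.nonneg m)
        · exact ((ih.isReward (m + 1)).integral_le (Q y)).trans
            (mul_le_mul_of_nonneg_left (hδ.anti (Nat.le_succ m)) hM)

lemma truncValue_mono [IsMarkovKernel Q] (hδ : IsDiscount δ) (hM : 0 ≤ M)
    (hf : IsReward M f) (hh : IsReward M h) (hS : MeasurableSet S) (m : ℕ) (y : X) :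
    Monotone fun N => truncValue δ Q f h S N m y := by
  have fam := truncValue_isDiscountedFamily (Q := Q) hδ hM hf hh hS
  refine monotone_nat_of_le_succ fun N => ?_
  induction N generalizing m y with
  | zero => exact (fam 1).nonneg m y
  | succ N ih =>
    by_cases hy : y ∈ S
    · rw [truncValue_succ_of_mem hy, truncValue_succ_of_mem hy]
    · rw [truncValue_succ_of_notMem hy, truncValue_succ_of_notMem hy]
      exact max_le_max le_rfl (integral_mono (((fam _).isReward _).integrable _)
        (((fam _).isReward _).integrable _) fun z => ih _ z)

/-- Extra steps only bring rewards from time `m + N` on. The error does not depend on `Q`, `f`, `h`,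
`S`, so one horizon later serves a whole sequence of problems. -/
lemma truncValue_add_le [IsMarkovKernel Q] (hδ : IsDiscount δ) (hM : 0 ≤ M)
    (hf : IsReward M f) (hh : IsReward M h) (hS : MeasurableSet S) (N k m : ℕ) (y : X) :
    truncValue δ Q f h S (N + k) m y ≤ truncValue δ Q f h S N m y + M * δ (m + N) := by
  have fam := truncValue_isDiscountedFamily (Q := Q) hδ hM hf hh hS
  induction N generalizing m y with
  | zero => simpa [truncValue] using (fam k).le m y
  | succ N ih =>
    have hnn : 0 ≤ M * δ (m + (N + 1)) := mul_nonneg hM (hδ.nonneg _)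
    rw [show N + 1 + k = N + k + 1 by ring]
    by_cases hy : y ∈ S
    · rw [truncValue_succ_of_mem hy, truncValue_succ_of_mem hy]
      linarith
    · rw [truncValue_succ_of_notMem hy, truncValue_succ_of_notMem hy]
      have i1 := ((fam N).isReward (m + 1)).integrable (Q y)
      have : ∫ z, truncValue δ Q f h S (N + k) (m + 1) z ∂Q y ≤
          ∫ z, truncValue δ Q f h S N (m + 1) z ∂Q y + M * δ (m + (N + 1)) := by
        calc _ ≤ ∫ z, (truncValue δ Q f h S N (m + 1) z + M * δ (m + (N + 1))) ∂Q y := by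
              refine integral_mono (((fam _).isReward _).integrable _)
                (i1.add (integrable_const _)) fun z => ?_
              have := ih (m + 1) z
              rwa [show m + 1 + N = m + (N + 1) by ring] at this
          _ = _ := by rw [integral_add i1 (integrable_const _)]; simp
      refine max_le ?_ ?_
      · linarith [le_max_left (δ m * h y) (∫ z, truncValue δ Q f h S N (m + 1) z ∂Q y)]
      · linarith [le_max_right (δ m * h y) (∫ z, truncValue δ Q f h S N (m + 1) z ∂Q y)]

lemma tendsto_truncValue [IsMarkovKernel Q] (hδ : IsDiscount δ) (hM : 0 ≤ M)
    (hf : IsReward M f) (hh : IsReward M h) (hS : MeasurableSet S) (m : ℕ) (y : X) :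
    Tendsto (fun N => truncValue δ Q f h S N m y) atTop (𝓝 (bellmanValue δ Q f h S m y)) :=
  tendsto_atTop_ciSup (truncValue_mono hδ hM hf hh hS m y)
    ⟨M * δ m, by
      rintro _ ⟨N, rfl⟩
      exact (truncValue_isDiscountedFamily hδ hM hf hh hS N).le m y⟩

lemma bellmanValue_isDiscountedFamily [IsMarkovKernel Q] (hδ : IsDiscount δ) (hM : 0 ≤ M)
    (hf : IsReward M f) (hh : IsReward M h) (hS : MeasurableSet S) :
    IsDiscountedFamily δ M (bellmanValue δ Q f h S) := by
  have fam := truncValue_isDiscountedFamily (Q := Q) hδ hM hf hh hS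
  have lim := tendsto_truncValue (Q := Q) hδ hM hf hh hS
  exact ⟨fun m => measurable_of_tendsto_metrizable (fun N => (fam N).measurable m)
      (tendsto_pi_nhds.2 (lim m)),
    fun m y => ge_of_tendsto' (lim m y) fun N => (fam N).nonneg m y,
    fun m y => le_of_tendsto' (lim m y) fun N => (fam N).le m y⟩

lemma bellmanValue_of_mem [IsMarkovKernel Q] (hδ : IsDiscount δ) (hM : 0 ≤ M)
    (hf : IsReward M f) (hh : IsReward M h) (hS : MeasurableSet S) {y : X} (hy : y ∈ S) (m : ℕ) :
    bellmanValue δ Q f h S m y = δ m * f y := by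
  refine tendsto_nhds_unique
    ((tendsto_add_atTop_iff_nat 1).2 (tendsto_truncValue hδ hM hf hh hS m y)) ?_
  simp_rw [truncValue_succ_of_mem hy]
  exact tendsto_const_nhds

lemma bellmanValue_of_notMem [IsMarkovKernel Q] (hδ : IsDiscount δ) (hM : 0 ≤ M)
    (hf : IsReward M f) (hh : IsReward M h) (hS : MeasurableSet S) {y : X} (hy : y ∉ S) (m : ℕ) :
    bellmanValue δ Q f h S m y =
      max (δ m * h y) (∫ z, bellmanValue δ Q f h S (m + 1) z ∂Q y) := by
  have fam := truncValue_isDiscountedFamily (Q := Q) hδ hM hf hh hS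
  refine tendsto_nhds_unique
    ((tendsto_add_atTop_iff_nat 1).2 (tendsto_truncValue hδ hM hf hh hS m y)) ?_
  simp_rw [truncValue_succ_of_notMem hy]
  refine tendsto_const_nhds.max (tendsto_integral_of_dominated_convergence
    (fun _ => M * δ (m + 1)) (fun N => ((fam N).measurable _).aestronglyMeasurable)
    (integrable_const _) (fun N => ae_of_all _ fun z => ?_)
    (ae_of_all _ fun z => tendsto_truncValue hδ hM hf hh hS _ z))
  rw [Real.norm_of_nonneg ((fam N).nonneg _ z)]
  exact (fam N).le _ z

lemma truncValue_le_bellmanValue [IsMarkovKernel Q] (hδ : IsDiscount δ) (hM : 0 ≤ M)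
    (hf : IsReward M f) (hh : IsReward M h) (hS : MeasurableSet S) (N m : ℕ) (y : X) :
    truncValue δ Q f h S N m y ≤ bellmanValue δ Q f h S m y :=
  (truncValue_mono hδ hM hf hh hS m y).ge_of_tendsto (tendsto_truncValue hδ hM hf hh hS m y) N

lemma bellmanValue_le_truncValue_add [IsMarkovKernel Q] (hδ : IsDiscount δ) (hM : 0 ≤ M)
    (hf : IsReward M f) (hh : IsReward M h) (hS : MeasurableSet S) (N m : ℕ) (y : X) :
    bellmanValue δ Q f h S m y ≤ truncValue δ Q f h S N m y + M * δ (m + N) := by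
  refine le_of_tendsto'
    ((tendsto_add_atTop_iff_nat N).2 (tendsto_truncValue hδ hM hf hh hS m y)) fun k => ?_
  rw [add_comm k N]
  exact truncValue_add_le hδ hM hf hh hS N k m y

/-- The expected discounted reward of stopping at the first entry time of `S` at or after time
`m`. -/
noncomputable def entryValue (δ : ℕ → ℝ) (Q : Kernel X X) (f : X → ℝ) (S : Set X) :
    ℕ → X → ℝ :=
  bellmanValue δ Q f (fun _ => 0) S

/-- The Snell envelope at time `m` over all stopping times up to the first entry time of `S`. -/
noncomputable def snellValue (δ : ℕ → ℝ) (Q : Kernel X X) (f : X → ℝ) (S : Set X) :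
    ℕ → X → ℝ :=
  bellmanValue δ Q f f S

end Value

/-! ### Optimality of waiting for the entry of a set -/

section SnellEntry

variable {X : Type*} [MeasurableSpace X] {δ : ℕ → ℝ} {M : ℝ}
  {Q : Kernel X X} [IsMarkovKernel Q] {f : X → ℝ} {S : Set X}

lemma entryValue_isDiscountedFamily (hδ : IsDiscount δ) (hM : 0 ≤ M) (hf : IsReward M f)
    (hS : MeasurableSet S) : IsDiscountedFamily δ M (entryValue δ Q f S) :=
  bellmanValue_isDiscountedFamily hδ hM hf (.zero hM) hS

lemma snellValue_isDiscountedFamily (hδ : IsDiscount δ) (hM : 0 ≤ M) (hf : IsReward M f)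
    (hS : MeasurableSet S) : IsDiscountedFamily δ M (snellValue δ Q f S) :=
  bellmanValue_isDiscountedFamily hδ hM hf hf hS

lemma entryValue_of_mem (hδ : IsDiscount δ) (hM : 0 ≤ M) (hf : IsReward M f)
    (hS : MeasurableSet S) {y : X} (hy : y ∈ S) (m : ℕ) :
    entryValue δ Q f S m y = δ m * f y :=
  bellmanValue_of_mem hδ hM hf (.zero hM) hS hy m

lemma entryValue_of_notMem (hδ : IsDiscount δ) (hM : 0 ≤ M) (hf : IsReward M f)
    (hS : MeasurableSet S) {y : X} (hy : y ∉ S) (m : ℕ) :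
    entryValue δ Q f S m y = ∫ z, entryValue δ Q f S (m + 1) z ∂Q y := by
  rw [entryValue, bellmanValue_of_notMem hδ hM hf (.zero hM) hS hy m, mul_zero]
  exact max_eq_right
    (integral_nonneg ((entryValue_isDiscountedFamily (Q := Q) hδ hM hf hS).nonneg _))

lemma snellValue_of_mem (hδ : IsDiscount δ) (hM : 0 ≤ M) (hf : IsReward M f)
    (hS : MeasurableSet S) {y : X} (hy : y ∈ S) (m : ℕ) :
    snellValue δ Q f S m y = δ m * f y :=
  bellmanValue_of_mem hδ hM hf hf hS hy m

lemma snellValue_of_notMem (hδ : IsDiscount δ) (hM : 0 ≤ M) (hf : IsReward M f)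
    (hS : MeasurableSet S) {y : X} (hy : y ∉ S) (m : ℕ) :
    snellValue δ Q f S m y = max (δ m * f y) (∫ z, snellValue δ Q f S (m + 1) z ∂Q y) :=
  bellmanValue_of_notMem hδ hM hf hf hS hy m

lemma mul_le_snellValue (hδ : IsDiscount δ) (hM : 0 ≤ M) (hf : IsReward M f)
    (hS : MeasurableSet S) (m : ℕ) (y : X) : δ m * f y ≤ snellValue δ Q f S m y := by
  by_cases hy : y ∈ S
  · rw [snellValue_of_mem hδ hM hf hS hy]
  · rw [snellValue_of_notMem hδ hM hf hS hy]
    exact le_max_left _ _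

/-- A larger set is entered no later, so its entry time competes in the Snell problem of the smaller
set. -/
lemma entryValue_le_snellValue_of_subset (hδ : IsDiscount δ) (hM : 0 ≤ M) (hf : IsReward M f)
    (hS : MeasurableSet S) {T : Set X} (hT : MeasurableSet T) (hST : S ⊆ T) (m : ℕ) (y : X) :
    entryValue δ Q f T m y ≤ snellValue δ Q f S m y := by
  refine (entryValue_isDiscountedFamily hδ hM hf hT).le_of_step (Q := Q) hδ
    (snellValue_isDiscountedFamily hδ hM hf hS) (fun m y => ?_) m y
  by_cases hy : y ∈ T
  · left
    rw [entryValue_of_mem hδ hM hf hT hy]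
    exact mul_le_snellValue hδ hM hf hS m y
  · right
    rw [entryValue_of_notMem hδ hM hf hT hy, snellValue_of_notMem hδ hM hf hS fun h => hy (hST h)]
    exact sub_le_sub_left (le_max_right _ _) _

/-- This is where log sub-additivity enters: postponing the problem by `m` costs at most the factor
`δ m`. -/
lemma mul_snellValue_le (hδ : IsDiscount δ) (hM : 0 ≤ M) (hf : IsReward M f)
    (hS : MeasurableSet S) (m t : ℕ) (y : X) :
    δ m * snellValue δ Q f S t y ≤ snellValue δ Q f S (m + t) y := by
  have fam := snellValue_isDiscountedFamily (Q := Q) hδ hM hf hS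
  have h1 : IsDiscountedFamily δ M fun t y => δ m * snellValue δ Q f S t y :=
    ⟨fun t => (fam.measurable t).const_mul _,
      fun t y => mul_nonneg (hδ.nonneg m) (fam.nonneg t y),
      fun t y => (mul_le_of_le_one_left (fam.nonneg t y) (hδ.le_one m)).trans (fam.le t y)⟩
  have h2 : IsDiscountedFamily δ M fun t y => snellValue δ Q f S (m + t) y :=
    ⟨fun t => fam.measurable _, fun t y => fam.nonneg _ y, fun t y => (fam.le _ y).trans
      (mul_le_mul_of_nonneg_left (hδ.anti (Nat.le_add_left t m)) hM)⟩
  refine h1.le_of_step (Q := Q) hδ h2 (fun t y => ?_) t y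
  have hmul : δ m * (δ t * f y) ≤ δ (m + t) * f y := by
    rw [← mul_assoc]
    exact mul_le_mul_of_nonneg_right (hδ.mul_le t m) (hf.nonneg y)
  by_cases hy : y ∈ S
  · left
    simpa only [snellValue_of_mem hδ hM hf hS hy] using hmul
  · rw [integral_const_mul]
    rw [snellValue_of_notMem hδ hM hf hS hy, snellValue_of_notMem hδ hM hf hS hy]
    -- Split by the optimal action on the left: continuing passes the excess to the next time,
    -- stopping is settled by `hmul`.
    rcases le_total (δ t * f y) (∫ z, snellValue δ Q f S (t + 1) z ∂Q y) with h | h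
    · right
      rw [max_eq_right h]
      exact sub_le_sub_left (le_max_right _ _) _
    · left
      rw [max_eq_left h]
      exact hmul.trans (le_max_left _ _)

/-- If one-step continuation with optimal stopping before the entry of `S` is never worse than
immediate stopping off `S`, then it is optimal to wait for the entry of `S`. -/
lemma snellValue_eq_entryValue (hδ : IsDiscount δ) (hM : 0 ≤ M) (hf : IsReward M f)
    (hS : MeasurableSet S) (h : ∀ y ∉ S, f y ≤ ∫ z, snellValue δ Q f S 1 z ∂Q y) :
    snellValue δ Q f S = entryValue δ Q f S := by
  have fam := snellValue_isDiscountedFamily (Q := Q) hδ hM hf hS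
  ext m y
  refine le_antisymm ?_ (entryValue_le_snellValue_of_subset hδ hM hf hS hS subset_rfl m y)
  refine fam.le_of_step (Q := Q) hδ (entryValue_isDiscountedFamily hδ hM hf hS) (fun m y => ?_) m y
  by_cases hy : y ∈ S
  · left
    rw [snellValue_of_mem hδ hM hf hS hy, entryValue_of_mem hδ hM hf hS hy]
  · right
    rw [snellValue_of_notMem hδ hM hf hS hy, entryValue_of_notMem hδ hM hf hS hy]
    refine sub_le_sub_right (max_le ?_ le_rfl) _
    -- The hypothesis concerns time `0` only; `mul_snellValue_le` transports it to time `m`.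
    calc δ m * f y ≤ δ m * ∫ z, snellValue δ Q f S 1 z ∂Q y :=
          mul_le_mul_of_nonneg_left (h y hy) (hδ.nonneg m)
      _ = ∫ z, δ m * snellValue δ Q f S 1 z ∂Q y := (integral_const_mul _ _).symm
      _ ≤ _ := integral_mono (((fam.isReward 1).integrable _).const_mul _)
          ((fam.isReward _).integrable _) (mul_snellValue_le hδ hM hf hS m 1)

end SnellEntry

/-! ### Stopping values on path space and the Bellman recursion -/

section PathSpace

variable {X : Type*} [MeasurableSpace X] {δ : ℕ → ℝ} {M : ℝ}
  {Q : Kernel X X} [IsMarkovKernel Q] {f : X → ℝ} {S : Set X}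

instance (x : X) : IsProbabilityMeasure (pathLaw Q x) := by
  unfold pathLaw
  infer_instance

/-- Formulated with a measurable `A` because `{x}` need not be measurable here; it is applied to a
level set. -/
lemma ae_pathLaw_zero (x : X) {A : Set X} (hA : MeasurableSet A) (hx : x ∈ A) :
    ∀ᵐ ω ∂pathLaw Q x, ω 0 ∈ A := by
  have hA' : MeasurableSet {ω : ℕ → X | ω 0 ∈ A}ᶜ := (measurable_pi_apply 0 hA).compl
  change pathLaw Q x {ω | ω 0 ∈ A}ᶜ = 0
  unfold pathLaw
  rw [← lintegral_indicator_one hA', Kernel.lintegral_traj _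
    (measurable_one.indicator hA')]
  convert! lintegral_zero with ω
  simp [Function.updateFinset, hx]

/-- The one-step Markov property of the path law. -/
lemma integral_pathLaw_succ (x : X) (n : ℕ) {g : X → ℝ} (hg : IsReward M g)
    {A : Set (Finset.Iic n → X)} (hA : MeasurableSet A) :
    ∫ ω, {ω : ℕ → X | Preorder.frestrictLe n ω ∈ A}.indicator (fun ω => g (ω (n + 1))) ω
        ∂pathLaw Q x =
      ∫ ω, {ω : ℕ → X | Preorder.frestrictLe n ω ∈ A}.indicator
        (fun ω => ∫ z, g z ∂Q (ω n)) ω ∂pathLaw Q x := by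
  set κ : (n : ℕ) → Kernel (Finset.Iic n → X) X := fun n =>
    Q.comap (fun p : (Finset.Iic n → X) => p ⟨n, Finset.mem_Iic.2 le_rfl⟩)
        (measurable_pi_apply _) with hκ
  have hmark : ∀ n, IsMarkovKernel (κ n) := fun n => by rw [hκ]; infer_instance
  have hp : pathLaw Q x = Kernel.traj (X := fun _ : ℕ => X) κ 0 (fun _ => x) := rfl
  have h1 := Kernel.partialTraj_compProd_eq_map_traj (X := fun _ : ℕ => X) (κ := κ)
    (Nat.zero_le n) (x₀ := fun _ => x)
  have h2 := Kernel.traj_map_frestrictLe_apply (X := fun _ : ℕ => X) (κ := κ) 0 n (fun _ => x)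
  rw [← hp] at h1 h2
  set F : (Finset.Iic n → X) × X → ℝ := (A ×ˢ Set.univ).indicator (fun q => g q.2) with hF
  have hFm : Measurable F := (hg.measurable.comp measurable_snd).indicator (hA.prod .univ)
  have hFi : Integrable F
      (Kernel.partialTraj (X := fun _ : ℕ => X) κ 0 n (fun _ => x) ⊗ₘ κ n) := by
    refine Integrable.of_bound hFm.aestronglyMeasurable M (ae_of_all _ fun q => ?_)
    rw [hF]
    refine (norm_indicator_le_norm_self _ _).trans ?_
    rw [Real.norm_of_nonneg (hg.nonneg _)]
    exact hg.le _
  have hm : Measurable fun ω : ℕ → X =>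
      (Preorder.frestrictLe (π := fun _ : ℕ => X) n ω, ω (n + 1)) := by fun_prop
  calc _ = ∫ q, F q ∂(pathLaw Q x).map
        (fun ω => (Preorder.frestrictLe (π := fun _ : ℕ => X) n ω, ω (n + 1))) := by
        rw [integral_map hm.aemeasurable hFm.aestronglyMeasurable]
        refine integral_congr_ae (ae_of_all _ fun ω => ?_)
        by_cases h : Preorder.frestrictLe (π := fun _ : ℕ => X) n ω ∈ A <;> simp [hF, h]
    _ = ∫ p, ∫ y, F (p, y) ∂κ n p ∂(pathLaw Q x).map (Preorder.frestrictLe n) := by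
        rw [← h1, Measure.integral_compProd hFi, h2]
    _ = ∫ p, A.indicator (fun p => ∫ z, g z ∂κ n p) p
          ∂(pathLaw Q x).map (Preorder.frestrictLe n) := by
        refine integral_congr_ae (ae_of_all _ fun p => ?_)
        by_cases h : p ∈ A <;> simp [hF, h]
    _ = _ := by
        rw [integral_map (by fun_prop)
          ((hg.measurable_integral (κ n)).indicator hA).aestronglyMeasurable]
        rfl

/-- The path avoids `S` at the times `1, …, n`. -/
def avoiding (S : Set X) (n : ℕ) : Set (ℕ → X) := {ω | ∀ t, 1 ≤ t → t ≤ n → ω t ∉ S}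

lemma avoiding_eq_preimage (hS : MeasurableSet S) (n : ℕ) :
    ∃ A : Set (Finset.Iic n → X), MeasurableSet A ∧
      avoiding S n = {ω : ℕ → X | Preorder.frestrictLe n ω ∈ A} := by
  refine ⟨⋂ t : Finset.Iic n, {p | 1 ≤ t.1 → p t ∉ S}, ?_, ?_⟩
  · refine MeasurableSet.iInter fun t => ?_
    by_cases ht : 1 ≤ t.1
    · simp only [ht, forall_const]
      exact (measurable_pi_apply t : Measurable fun p : Finset.Iic n → X => p t) hS.compl
    · simp [ht]
  · ext ω
    simp only [avoiding, Set.mem_ofPred_eq, Set.mem_iInter, Preorder.frestrictLe_apply,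
      Subtype.forall, Finset.mem_Iic]
    exact ⟨fun h t h1 h2 => h t h2 h1, fun h t h1 h2 => h t h2 h1⟩

lemma measurableSet_avoiding (hS : MeasurableSet S) (n : ℕ) : MeasurableSet (avoiding S n) := by
  obtain ⟨A, hA, h⟩ := avoiding_eq_preimage hS n
  rw [h]
  exact (Preorder.measurable_frestrictLe n) hA

omit [MeasurableSpace X] in
lemma discountedReward_rho_of_first {ω : ℕ → X} {n : ℕ} (h : ω ∈ avoiding S n)
    (hn : ω (n + 1) ∈ S) : discountedReward δ f (rho S) ω = δ (n + 1) * f (ω (n + 1)) := by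
  have hex : ∃ j, 1 ≤ j ∧ ω j ∈ S := ⟨n + 1, by omega, hn⟩
  have hinf : sInf {i : ℕ | 1 ≤ i ∧ ω i ∈ S} = n + 1 := by
    refine le_antisymm (Nat.sInf_le ⟨by omega, hn⟩) (le_csInf hex fun t ht => ?_)
    by_contra hlt
    exact h t ht.1 (by omega) ht.2
  have hrho : rho S ω = ((n + 1 : ℕ) : WithTop ℕ) := by
    rw [← hinf]
    simp only [rho, hittingAfter, if_pos hex]
    rfl
  unfold discountedReward
  rw [hrho]
  rfl

omit [MeasurableSpace X] in
lemma discountedReward_rho_of_avoiding {ω : ℕ → X} (h : ∀ n, ω ∈ avoiding S n) :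
    discountedReward δ f (rho S) ω = 0 := by
  have : rho S ω = ⊤ := hittingAfter_eq_top_iff.2 fun j hj => h j j hj le_rfl
  simp [discountedReward, this]

/-- The entry value along the path, stopped at the first entry of `S` at a positive time, as the
sum of its martingale increments. -/
noncomputable def stoppedEntryValue (δ : ℕ → ℝ) (Q : Kernel X X) (f : X → ℝ) (S : Set X)
    (n : ℕ) (ω : ℕ → X) : ℝ :=
  ∫ z, entryValue δ Q f S 1 z ∂Q (ω 0) + ∑ k ∈ Finset.range n,
    ((avoiding S k).indicator (fun ω => entryValue δ Q f S (k + 1) (ω (k + 1))) ω -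
      (avoiding S k).indicator (fun ω => ∫ z, entryValue δ Q f S (k + 1) z ∂Q (ω k)) ω)

/-- The sum telescopes: off `S` the entry value equals its one-step integral, at the entry it equals
the reward, and afterwards the indicators vanish. Time `0` is not tested, so starting points in `S`
are covered. -/
lemma stoppedEntryValue_eq (hδ : IsDiscount δ) (hM : 0 ≤ M) (hf : IsReward M f)
    (hS : MeasurableSet S) (n : ℕ) (ω : ℕ → X) :
    (ω ∈ avoiding S n → stoppedEntryValue δ Q f S n ω =
      ∫ z, entryValue δ Q f S (n + 1) z ∂Q (ω n)) ∧
    (ω ∉ avoiding S n → stoppedEntryValue δ Q f S n ω = discountedReward δ f (rho S) ω) := by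
  induction n with
  | zero =>
    refine ⟨fun _ => by simp [stoppedEntryValue], fun h => absurd ?_ h⟩
    intro t h1 h2
    omega
  | succ n ih =>
    have hsucc : stoppedEntryValue δ Q f S (n + 1) ω = stoppedEntryValue δ Q f S n ω +
        ((avoiding S n).indicator (fun ω => entryValue δ Q f S (n + 1) (ω (n + 1))) ω -
          (avoiding S n).indicator (fun ω => ∫ z, entryValue δ Q f S (n + 1) z ∂Q (ω n)) ω) := by
      simp only [stoppedEntryValue, Finset.sum_range_succ]
      ring
    by_cases h : ω ∈ avoiding S n
    · rw [hsucc, Set.indicator_of_mem h, Set.indicator_of_mem h, ih.1 h, add_sub_cancel]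
      refine ⟨fun h' => ?_, fun h' => ?_⟩
      · exact entryValue_of_notMem hδ hM hf hS (h' (n + 1) (by omega) le_rfl) _
      · have hn : ω (n + 1) ∈ S := by
          by_contra hn
          refine h' fun t h1 h2 => ?_
          rcases Nat.le_succ_iff.1 h2 with h3 | rfl
          · exact h t h1 h3
          · exact hn
        rw [entryValue_of_mem hδ hM hf hS hn, discountedReward_rho_of_first h hn]
    · rw [hsucc, Set.indicator_of_notMem h, Set.indicator_of_notMem h, ih.2 h]
      refine ⟨fun h' => absurd (fun t h1 h2 => h' t h1 (by omega)) h, fun _ => by simp⟩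

lemma tendsto_stoppedEntryValue (hδ : IsDiscount δ) (hM : 0 ≤ M) (hf : IsReward M f)
    (hS : MeasurableSet S) (ω : ℕ → X) :
    Tendsto (fun n => stoppedEntryValue δ Q f S n ω) atTop
      (𝓝 (discountedReward δ f (rho S) ω)) := by
  have fam := entryValue_isDiscountedFamily (Q := Q) hδ hM hf hS
  by_cases h : ∀ n, ω ∈ avoiding S n
  · rw [discountedReward_rho_of_avoiding h]
    have hlim : Tendsto (fun n => M * δ (n + 1)) atTop (𝓝 0) := by
      simpa using (hδ.tendsto.comp (tendsto_add_atTop_nat 1)).const_mul M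
    refine squeeze_zero (fun n => ?_) (fun n => ?_) hlim
    · rw [(stoppedEntryValue_eq hδ hM hf hS n ω).1 (h n)]
      exact (fam.isReward _).integral_nonneg _
    · rw [(stoppedEntryValue_eq hδ hM hf hS n ω).1 (h n)]
      exact (fam.isReward _).integral_le _
  · push Not at h
    obtain ⟨N, hN⟩ := h
    refine tendsto_const_nhds.congr' ?_
    filter_upwards [eventually_ge_atTop N] with n hn
    exact ((stoppedEntryValue_eq hδ hM hf hS n ω).2
      fun h => hN fun t h1 h2 => h t h1 (h2.trans hn)).symm

lemma discountedReward_mem_Icc (hδ : IsDiscount δ) (hM : 0 ≤ M) (hf : IsReward M f)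
    (τ : (ℕ → X) → WithTop ℕ) (ω : ℕ → X) : discountedReward δ f τ ω ∈ Set.Icc 0 M := by
  unfold discountedReward
  split
  · exact ⟨le_rfl, hM⟩
  · next t _ => exact ⟨mul_nonneg (hδ.nonneg t) (hf.nonneg _),
      (mul_le_of_le_one_left (hf.nonneg _) (hδ.le_one t)).trans (hf.le _)⟩

lemma isReward_stoppedEntryValue (hδ : IsDiscount δ) (hM : 0 ≤ M) (hf : IsReward M f)
    (hS : MeasurableSet S) (n : ℕ) : IsReward M (stoppedEntryValue δ Q f S n) := by
  have fam := entryValue_isDiscountedFamily (Q := Q) hδ hM hf hS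
  have hmem : ∀ ω, stoppedEntryValue δ Q f S n ω ∈ Set.Icc 0 M := fun ω => by
    by_cases h : ω ∈ avoiding S n
    · rw [(stoppedEntryValue_eq hδ hM hf hS n ω).1 h]
      exact ⟨(fam.isReward _).integral_nonneg _,
        (fam.isReward_bound hδ hM _).integral_le _⟩
    · rw [(stoppedEntryValue_eq hδ hM hf hS n ω).2 h]
      exact discountedReward_mem_Icc hδ hM hf _ ω
  refine ⟨?_, fun ω => (hmem ω).1, fun ω => (hmem ω).2⟩
  refine (((fam.isReward 1).measurable_integral Q).comp (measurable_pi_apply 0)).add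
    (Finset.measurable_sum _ fun k _ => Measurable.sub ?_ ?_)
  · exact ((fam.measurable _).comp (measurable_pi_apply _)).indicator (measurableSet_avoiding hS k)
  · exact (((fam.isReward _).measurable_integral Q).comp (measurable_pi_apply _)).indicator
      (measurableSet_avoiding hS k)

/-- Each increment has mean zero by the Markov property, since avoidance up to time `n` depends on
the path up to `n` only. -/
lemma integral_stoppedEntryValue (hδ : IsDiscount δ) (hM : 0 ≤ M) (hf : IsReward M f)
    (hS : MeasurableSet S) (n : ℕ) (x : X) :
    ∫ ω, stoppedEntryValue δ Q f S n ω ∂pathLaw Q x = ∫ z, entryValue δ Q f S 1 z ∂Q x := by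
  have fam := entryValue_isDiscountedFamily (Q := Q) hδ hM hf hS
  induction n with
  | zero =>
    have hmeas := (fam.isReward 1).measurable_integral Q
    have hae := ae_pathLaw_zero (Q := Q) x
      (hmeas (measurableSet_singleton (∫ z, entryValue δ Q f S 1 z ∂Q x))) rfl
    rw [integral_congr_ae (g := fun _ => ∫ z, entryValue δ Q f S 1 z ∂Q x)]
    · simp
    · filter_upwards [hae] with ω hω
      simpa [stoppedEntryValue] using hω
  | succ n ih =>
    rw [← ih, ← sub_eq_zero, ← integral_sub
      ((isReward_stoppedEntryValue hδ hM hf hS _).integrable _)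
      ((isReward_stoppedEntryValue hδ hM hf hS _).integrable _)]
    simp only [stoppedEntryValue, Finset.sum_range_succ, ← add_assoc, add_sub_cancel_left]
    obtain ⟨A, hA, hAeq⟩ := avoiding_eq_preimage hS n
    rw [hAeq, integral_sub, integral_pathLaw_succ x n (fam.isReward (n + 1)) hA, sub_self]
    · refine Integrable.indicator ?_ (Preorder.measurable_frestrictLe n hA)
      exact IsReward.integrable (M := M * δ (n + 1)) ⟨(fam.measurable _).comp
        (measurable_pi_apply _), fun ω => fam.nonneg _ _, fun ω => fam.le _ _⟩ _
    · refine Integrable.indicator ?_ (Preorder.measurable_frestrictLe n hA)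
      exact IsReward.integrable (M := M * δ (n + 1))
        ⟨((fam.isReward _).measurable_integral Q).comp (measurable_pi_apply _),
        fun ω => (fam.isReward _).integral_nonneg _, fun ω => (fam.isReward _).integral_le _⟩ _

/-- The stopping value of the first positive entry time solves the Bellman recursion. -/
lemma stopValue_rho (hδ : IsDiscount δ) (hM : 0 ≤ M) (hf : IsReward M f)
    (hS : MeasurableSet S) (x : X) :
    stopValue δ Q x (rho S) f = ∫ z, entryValue δ Q f S 1 z ∂Q x := by
  have hrew := isReward_stoppedEntryValue (Q := Q) hδ hM hf hS
  have hlim := tendsto_integral_of_dominated_convergence (μ := pathLaw Q x) (fun _ => M)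
    (fun n => (hrew n).measurable.aestronglyMeasurable) (integrable_const M)
    (fun n => ae_of_all _ fun ω => by
      rw [Real.norm_of_nonneg ((hrew n).nonneg ω)]; exact (hrew n).le ω)
    (ae_of_all _ fun ω => tendsto_stoppedEntryValue hδ hM hf hS ω)
  simp_rw [integral_stoppedEntryValue hδ hM hf hS] at hlim
  exact (tendsto_nhds_unique hlim tendsto_const_nhds)

end PathSpace

/-! ### Upper semicontinuity under total variation convergence -/

section Stability

variable {X : Type*} [MeasurableSpace X] {δ : ℕ → ℝ} {M : ℝ}

lemma ofReal_integral_sub_le_tvDist {μ ν : Measure X} {g : X → ℝ} (hg : Measurable g)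
    (hg' : ∀ y, g y ∈ Set.Icc (-1 : ℝ) 1) :
    ENNReal.ofReal (∫ y, g y ∂μ - ∫ y, g y ∂ν) ≤ tvDist μ ν :=
  le_iSup₂_of_le g ⟨hg, hg'⟩ le_rfl

lemma integral_mem_Icc_of_mem_Icc (μ : Measure X) [IsProbabilityMeasure μ] {g : X → ℝ}
    (hg' : ∀ y, g y ∈ Set.Icc (-1 : ℝ) 1) : ∫ y, g y ∂μ ∈ Set.Icc (-1 : ℝ) 1 := by
  rw [Set.mem_Icc, ← abs_le]
  simpa using norm_integral_le_of_norm_le_const (μ := μ) (f := g) (C := 1)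
    (ae_of_all _ fun y => abs_le.2 (hg' y))

lemma tvDist_ne_top (μ ν : Measure X) [IsProbabilityMeasure μ] [IsProbabilityMeasure ν] :
    tvDist μ ν ≠ ⊤ := by
  refine ne_top_of_le_ne_top (ENNReal.ofReal_ne_top (r := 2)) (iSup₂_le fun g hg => ?_)
  refine ENNReal.ofReal_le_ofReal ?_
  linarith [(integral_mem_Icc_of_mem_Icc μ hg.2).2, (integral_mem_Icc_of_mem_Icc ν hg.2).1]

lemma IsReward.integral_sub_le_tvDist {μ ν : Measure X} [IsProbabilityMeasure μ]
    [IsProbabilityMeasure ν] (hM : 0 < M) {g : X → ℝ} (hg : IsReward M g) :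
    ∫ y, g y ∂μ - ∫ y, g y ∂ν ≤ M * (tvDist μ ν).toReal := by
  -- Rescale `g` into `[0, 1]` to make it an admissible test function.
  have h := ofReal_integral_sub_le_tvDist (μ := μ) (ν := ν) (g := fun y => M⁻¹ * g y)
    (hg.measurable.const_mul _) fun y =>
      ⟨by linarith [mul_nonneg (inv_nonneg.2 hM.le) (hg.nonneg y)], by
        rw [inv_mul_le_iff₀ hM, mul_one]; exact hg.le y⟩
  rw [ENNReal.ofReal_le_iff_le_toReal (tvDist_ne_top μ ν), integral_const_mul, integral_const_mul,
    ← mul_sub, inv_mul_le_iff₀ hM] at h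
  exact h

variable {Q : ℕ → Kernel X X} [∀ n, IsMarkovKernel (Q n)] {Qlim : Kernel X X}
  [IsMarkovKernel Qlim] {f : ℕ → X → ℝ} {flim : X → ℝ} {S : ℕ → Set X} {T : Set X}

lemma tendsto_integral_max_sub (μ : Measure X) [IsFiniteMeasure μ] {a : ℕ → X → ℝ} {b : X → ℝ}
    (ha : ∀ n, IsReward M (a n)) (hb : IsReward M b)
    (h : ∀ y, Tendsto (fun n => max 0 (a n y - b y)) atTop (𝓝 0)) :
    Tendsto (fun n => ∫ y, max 0 (a n y - b y) ∂μ) atTop (𝓝 0) := by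
  have := tendsto_integral_of_dominated_convergence (μ := μ) (fun _ => M)
    (F := fun n y => max 0 (a n y - b y)) (f := fun _ => 0)
    (fun n => (measurable_const.max ((ha n).measurable.sub hb.measurable)).aestronglyMeasurable)
    (integrable_const M) (fun n => ae_of_all _ fun y => ?_) (ae_of_all _ h)
  · simpa using this
  · rw [Real.norm_of_nonneg (le_max_left _ _)]
    exact max_le ((hb.nonneg y).trans (hb.le y)) (by linarith [(ha n).le y, hb.nonneg y])

/-- Total variation controls the change of measure uniformly over integrands, so `a` may vary along
with `μ`; the rest is an integral against the fixed `ν`, open to dominated convergence. -/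
lemma integral_sub_integral_le {μ ν : Measure X} [IsProbabilityMeasure μ]
    [IsProbabilityMeasure ν] (hM : 0 < M) {a b : X → ℝ} (ha : IsReward M a) (hb : IsReward M b) :
    ∫ y, a y ∂μ - ∫ y, b y ∂ν ≤
      M * (tvDist μ ν).toReal + ∫ y, max 0 (a y - b y) ∂ν := by
  have h1 := ha.integral_sub_le_tvDist (μ := μ) (ν := ν) hM
  have i := (ha.integrable ν).sub (hb.integrable ν)
  have h2 : ∫ y, (a y - b y) ∂ν ≤ ∫ y, max 0 (a y - b y) ∂ν :=
    integral_mono i ((integrable_const (0 : ℝ)).sup i) fun y => le_max_right _ _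
  rw [integral_sub (ha.integrable ν) (hb.integrable ν)] at h2
  linarith

/-- Upper semicontinuity of the truncated Snell envelopes. -/
lemma tendsto_max_truncValue_sub (hδ : IsDiscount δ) (hM : 0 < M) (hf : ∀ n, IsReward M (f n))
    (hflim : IsReward M flim) (hS : ∀ n, MeasurableSet (S n)) (hT : MeasurableSet T)
    (hQ : ∀ y, Tendsto (fun n => (tvDist (Q n y) (Qlim y)).toReal) atTop (𝓝 0))
    (hfl : ∀ y, Tendsto (fun n => f n y) atTop (𝓝 (flim y)))
    (hST : ∀ y ∈ T, ∀ᶠ n in atTop, y ∈ S n) (N m : ℕ) (y : X) :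
    Tendsto (fun n => max 0 (truncValue δ (Q n) (f n) (f n) (S n) N m y -
      truncValue δ Qlim flim flim T N m y)) atTop (𝓝 0) := by
  induction N generalizing m y with
  | zero => simp [truncValue]
  | succ N ih =>
    have fam := fun n => truncValue_isDiscountedFamily (Q := Q n) hδ hM.le (hf n) (hf n) (hS n) N
    have faml := truncValue_isDiscountedFamily (Q := Qlim) hδ hM.le hflim hflim hT N
    have hr := fun n => (fam n).isReward_bound hδ hM.le (m + 1)
    have hrl := faml.isReward_bound hδ hM.le (m + 1)
    have habs : Tendsto (fun n => δ m * |f n y - flim y|) atTop (𝓝 0) := by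
      have := (((hfl y).sub_const (flim y)).abs).const_mul (δ m)
      simpa using this
    have hint := tendsto_integral_max_sub (Qlim y) hr hrl (ih (m + 1))
    have hbound : Tendsto (fun n => δ m * |f n y - flim y| +
        (M * (tvDist (Q n y) (Qlim y)).toReal +
          ∫ z, max 0 (truncValue δ (Q n) (f n) (f n) (S n) N (m + 1) z -
            truncValue δ Qlim flim flim T N (m + 1) z) ∂Qlim y)) atTop (𝓝 0) := by
      simpa using habs.add (((hQ y).const_mul M).add hint)
    refine tendsto_of_tendsto_of_tendsto_of_le_of_le' tendsto_const_nhds hbound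
      (Eventually.of_forall fun n => le_max_left _ _) ?_
    have hev : ∀ᶠ n in atTop, y ∈ T → y ∈ S n := by
      by_cases hy : y ∈ T
      · exact (hST y hy).mono fun n h _ => h
      · exact Eventually.of_forall fun n h => absurd h hy
    filter_upwards [hev] with n hn
    have hc : 0 ≤ δ m * |f n y - flim y| := mul_nonneg (hδ.nonneg m) (abs_nonneg _)
    have hd : δ m * f n y - δ m * flim y ≤ δ m * |f n y - flim y| := by
      rw [← mul_sub]
      exact mul_le_mul_of_nonneg_left (le_abs_self _) (hδ.nonneg m)
    have he : 0 ≤ M * (tvDist (Q n y) (Qlim y)).toReal :=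
      mul_nonneg hM.le ENNReal.toReal_nonneg
    have hi : 0 ≤ ∫ z, max 0 (truncValue δ (Q n) (f n) (f n) (S n) N (m + 1) z -
            truncValue δ Qlim flim flim T N (m + 1) z) ∂Qlim y :=
      integral_nonneg fun z => le_max_left _ _
    have hs := integral_sub_integral_le (μ := Q n y) (ν := Qlim y) hM (hr n) hrl
    refine max_le (by linarith) ?_
    by_cases hyT : y ∈ T
    · rw [truncValue_succ_of_mem hyT, truncValue_succ_of_mem (hn hyT)]
      linarith
    · rw [truncValue_succ_of_notMem hyT]
      have hl := le_max_left (δ m * flim y)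
        (∫ z, truncValue δ Qlim flim flim T N (m + 1) z ∂Qlim y)
      have hr := le_max_right (δ m * flim y)
        (∫ z, truncValue δ Qlim flim flim T N (m + 1) z ∂Qlim y)
      -- Off `T`, forced stopping on `S n` is harmless for an upper bound: its payoff is, up to a
      -- vanishing error, one of the two options in the limit problem.
      by_cases hyS : y ∈ S n
      · rw [truncValue_succ_of_mem hyS]
        linarith
      · rw [truncValue_succ_of_notMem hyS, sub_le_iff_le_add]
        exact max_le (by linarith) (by linarith)

/-- Upper semicontinuity of the optimal continuation value up to the entry time of a set. -/
lemma eventually_integral_snellValue_lt (hδ : IsDiscount δ) (hM : 0 < M)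
    (hf : ∀ n, IsReward M (f n))
    (hflim : IsReward M flim) (hS : ∀ n, MeasurableSet (S n)) (hT : MeasurableSet T)
    (hQ : ∀ y, Tendsto (fun n => (tvDist (Q n y) (Qlim y)).toReal) atTop (𝓝 0))
    (hfl : ∀ y, Tendsto (fun n => f n y) atTop (𝓝 (flim y)))
    (hST : ∀ y ∈ T, ∀ᶠ n in atTop, y ∈ S n) (x : X) {c : ℝ}
    (hc : ∫ z, snellValue δ Qlim flim T 1 z ∂Qlim x < c) :
    ∀ᶠ n in atTop, ∫ z, snellValue δ (Q n) (f n) (S n) 1 z ∂Q n x < c := by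
  set u := ∫ z, snellValue δ Qlim flim T 1 z ∂Qlim x with hu
  have htail : Tendsto (fun N => M * δ (1 + N)) atTop (𝓝 0) := by
    have := ((tendsto_add_atTop_iff_nat 1).2 hδ.tendsto).const_mul M
    simpa [add_comm] using this
  -- Half of the gap `c - u` pays for truncation, uniformly in `n`; the other half for the
  -- convergence at the fixed horizon `N`.
  obtain ⟨N, hN⟩ := (htail.eventually (gt_mem_nhds (half_pos (sub_pos.2 hc)))).exists
  have fam := fun n => truncValue_isDiscountedFamily (Q := Q n) hδ hM.le (hf n) (hf n) (hS n) N
  have faml := truncValue_isDiscountedFamily (Q := Qlim) hδ hM.le hflim hflim hT N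
  have hr := fun n => (fam n).isReward_bound hδ hM.le 1
  have hrl := faml.isReward_bound hδ hM.le 1
  have hint := tendsto_integral_max_sub (Qlim x) hr hrl
    (tendsto_max_truncValue_sub hδ hM hf hflim hS hT hQ hfl hST N 1)
  have hlim : Tendsto (fun n => M * (tvDist (Q n x) (Qlim x)).toReal +
      ∫ z, max 0 (truncValue δ (Q n) (f n) (f n) (S n) N 1 z -
        truncValue δ Qlim flim flim T N 1 z) ∂Qlim x) atTop (𝓝 0) := by
    simpa using ((hQ x).const_mul M).add hint
  filter_upwards [hlim.eventually (gt_mem_nhds (half_pos (sub_pos.2 hc)))] with n hn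
  have hs := integral_sub_integral_le (μ := Q n x) (ν := Qlim x) hM (hr n) hrl
  have h1 : ∫ z, snellValue δ (Q n) (f n) (S n) 1 z ∂Q n x ≤
      ∫ z, truncValue δ (Q n) (f n) (f n) (S n) N 1 z ∂Q n x + M * δ (1 + N) := by
    calc _ ≤ ∫ z, (truncValue δ (Q n) (f n) (f n) (S n) N 1 z + M * δ (1 + N)) ∂Q n x :=
          integral_mono
            (((snellValue_isDiscountedFamily hδ hM.le (hf n) (hS n)).isReward 1).integrable _)
            (((hr n).integrable _).add (integrable_const _))
            (bellmanValue_le_truncValue_add hδ hM.le (hf n) (hf n) (hS n) N 1)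
      _ = _ := by rw [integral_add ((hr n).integrable _) (integrable_const _)]; simp
  have h2 : ∫ z, truncValue δ Qlim flim flim T N 1 z ∂Qlim x ≤ u :=
    integral_mono (hrl.integrable _)
      (((snellValue_isDiscountedFamily hδ hM.le hflim hT).isReward 1).integrable _)
      (truncValue_le_bellmanValue hδ hM.le hflim hflim hT N 1)
  linarith

end Stability

/-! ### Construction and optimality of the smallest equilibrium -/

section Equilibria

variable {X : Type*} [MeasurableSpace X] {δ : ℕ → ℝ} {M : ℝ}
  {Q : Kernel X X} [IsMarkovKernel Q] {f : X → ℝ} {S : Set X}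

/-- Starting from `∅`, keep adding the states where immediate stopping is strictly better than
optimal stopping before the entry of the current set. -/
def stoppingIterate (δ : ℕ → ℝ) (Q : Kernel X X) (f : X → ℝ) : ℕ → Set X
  | 0 => ∅
  | k + 1 => stoppingIterate δ Q f k ∪
      {x | ∫ z, snellValue δ Q f (stoppingIterate δ Q f k) 1 z ∂Q x < f x}

lemma stopValue_le_integral_snellValue (hδ : IsDiscount δ) (hM : 0 ≤ M) (hf : IsReward M f)
    (hS : MeasurableSet S) {T : Set X} (hT : MeasurableSet T) (hST : S ⊆ T) (x : X) :
    stopValue δ Q x (rho T) f ≤ ∫ z, snellValue δ Q f S 1 z ∂Q x := by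
  rw [stopValue_rho hδ hM hf hT]
  exact integral_mono (((entryValue_isDiscountedFamily hδ hM hf hT).isReward 1).integrable _)
    (((snellValue_isDiscountedFamily hδ hM hf hS).isReward 1).integrable _)
    (entryValue_le_snellValue_of_subset hδ hM hf hS hT hST 1)

lemma stopValue_eq_integral_snellValue (hδ : IsDiscount δ) (hM : 0 ≤ M) (hf : IsReward M f)
    (hS : MeasurableSet S) (h : ∀ y ∉ S, f y ≤ ∫ z, snellValue δ Q f S 1 z ∂Q y) (x : X) :
    stopValue δ Q x (rho S) f = ∫ z, snellValue δ Q f S 1 z ∂Q x := by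
  rw [stopValue_rho hδ hM hf hS, snellValue_eq_entryValue hδ hM hf hS h]

lemma IsEquilibrium.le_integral_snellValue (hδ : IsDiscount δ) (hM : 0 ≤ M) (hf : IsReward M f)
    (h : IsEquilibrium δ Q f S) (y : X) (hy : y ∉ S) :
    f y ≤ ∫ z, snellValue δ Q f S 1 z ∂Q y :=
  (h.2.1 y hy).trans (stopValue_le_integral_snellValue hδ hM hf h.1 h.1 subset_rfl y)

lemma measurableSet_stoppingIterate (hδ : IsDiscount δ) (hM : 0 ≤ M) (hf : IsReward M f) (k : ℕ) :
    MeasurableSet (stoppingIterate δ Q f k) := by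
  induction k with
  | zero => exact .empty
  | succ k ih =>
    exact ih.union (measurableSet_lt
      (((snellValue_isDiscountedFamily hδ hM hf ih).isReward 1).measurable_integral Q)
      hf.measurable)

omit [IsMarkovKernel Q] in
lemma monotone_stoppingIterate : Monotone (stoppingIterate δ Q f) :=
  monotone_nat_of_le_succ fun _ => Set.subset_union_left

/-- A point added outside `S` would satisfy `f x ≤` stopping value of `S` `≤` Snell continuation
value of the iterate `< f x`. -/
lemma stoppingIterate_subset (hδ : IsDiscount δ) (hM : 0 ≤ M) (hf : IsReward M f)
    (hS : IsEquilibrium δ Q f S) (k : ℕ) : stoppingIterate δ Q f k ⊆ S := by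
  induction k with
  | zero => exact Set.empty_subset _
  | succ k ih =>
    refine Set.union_subset ih fun x hx => ?_
    by_contra hxS
    exact absurd ((hS.2.1 x hxS).trans (stopValue_le_integral_snellValue hδ hM hf
      (measurableSet_stoppingIterate hδ hM hf k) hS.1 ih x)) (not_le.2 hx)

lemma tvDist_self (μ : Measure X) : tvDist μ μ = 0 := by
  simp [tvDist]

lemma isEquilibrium_iUnion_stoppingIterate (hδ : IsDiscount δ) (hM : 0 < M)
    (hf : IsReward M f) : IsEquilibrium δ Q f (⋃ k, stoppingIterate δ Q f k) := by
  have hk := measurableSet_stoppingIterate (Q := Q) hδ hM.le hf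
  have hmeas := MeasurableSet.iUnion hk
  have hle : ∀ x ∉ ⋃ k, stoppingIterate δ Q f k,
      f x ≤ ∫ z, snellValue δ Q f (⋃ k, stoppingIterate δ Q f k) 1 z ∂Q x := by
    intro x hx
    by_contra! hlt
    -- Apply the semicontinuity with constant data and the iterates as sets: a strict inequality at
    -- the union already holds at some stage `k`, so `x` is added at stage `k + 1`.
    obtain ⟨k, h⟩ := (eventually_integral_snellValue_lt (Q := fun _ => Q) (f := fun _ => f) hδ hM
      (fun _ => hf) hf hk hmeas (fun y => by simp [tvDist_self]) (fun y => tendsto_const_nhds)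
      (fun y hy => by
        obtain ⟨k, hk⟩ := Set.mem_iUnion.1 hy
        filter_upwards [eventually_ge_atTop k] with n hn
        exact monotone_stoppingIterate hn hk) x hlt).exists
    exact hx (Set.mem_iUnion.2 ⟨k + 1, Or.inr h⟩)
  refine ⟨hmeas, fun x hx => ?_, fun x hx => ?_⟩
  · rw [stopValue_eq_integral_snellValue hδ hM.le hf hmeas hle]
    exact hle x hx
  -- At the stage where `x` is added, `f x` beats the Snell continuation value of a smaller set,
  -- which dominates the stopping value of the union.
  · obtain ⟨k, hxk⟩ := Set.mem_iUnion.1 hx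
    clear hx
    induction k with
    | zero => exact absurd hxk (Set.notMem_empty x)
    | succ k ih =>
      rcases hxk with hxk | hxk
      · exact ih hxk
      · exact (stopValue_le_integral_snellValue hδ hM.le hf (hk k) hmeas
          (Set.subset_iUnion _ k) x).trans (le_of_lt hxk)

lemma smallestEquilibrium_eq (hδ : IsDiscount δ) (hM : 0 < M) (hf : IsReward M f) :
    smallestEquilibrium δ f Q = ⋃ k, stoppingIterate δ Q f k :=
  (Set.sInter_subset_of_mem (isEquilibrium_iUnion_stoppingIterate hδ hM hf)).antisymm
    (Set.subset_sInter fun _ hS => Set.iUnion_subset (stoppingIterate_subset hδ hM.le hf hS))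

lemma isEquilibrium_smallestEquilibrium (hδ : IsDiscount δ) (hM : 0 < M) (hf : IsReward M f) :
    IsEquilibrium δ Q f (smallestEquilibrium δ f Q) := by
  rw [smallestEquilibrium_eq hδ hM hf]
  exact isEquilibrium_iUnion_stoppingIterate hδ hM hf

lemma IsEquilibrium.stopValue_eq (hδ : IsDiscount δ) (hM : 0 ≤ M) (hf : IsReward M f)
    (h : IsEquilibrium δ Q f S) (x : X) :
    stopValue δ Q x (rho S) f = ∫ z, snellValue δ Q f S 1 z ∂Q x :=
  stopValue_eq_integral_snellValue hδ hM hf h.1 (h.le_integral_snellValue hδ hM hf) x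

/-- The smallest equilibrium is optimal. -/
lemma policyValue_le_smallestEquilibrium (hδ : IsDiscount δ) (hM : 0 < M) (hf : IsReward M f)
    (hS : IsEquilibrium δ Q f S) (x : X) :
    policyValue δ Q x S f ≤ policyValue δ Q x (smallestEquilibrium δ f Q) f := by
  have hE := isEquilibrium_smallestEquilibrium (Q := Q) hδ hM hf
  have hsub : smallestEquilibrium δ f Q ⊆ S := Set.sInter_subset_of_mem hS
  unfold policyValue
  by_cases hx : x ∈ S
  · by_cases hx' : x ∈ smallestEquilibrium δ f Q
    · rw [if_pos hx, if_pos hx']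
    · rw [if_pos hx, if_neg hx']
      exact hE.2.1 x hx'
  · rw [if_neg hx, if_neg fun h => hx (hsub h), hE.stopValue_eq hδ hM.le hf]
    exact stopValue_le_integral_snellValue hδ hM.le hf hE.1 hS.1 hsub x

lemma optimalValue_le (hδ : IsDiscount δ) (hM : 0 < M) (hf : IsReward M f) (x : X) :
    optimalValue δ Q x f ≤ policyValue δ Q x (smallestEquilibrium δ f Q) f :=
  iSup₂_le fun _ hS => EReal.coe_le_coe_iff.2 (policyValue_le_smallestEquilibrium hδ hM hf hS x)

lemma le_optimalValue (hδ : IsDiscount δ) (hM : 0 < M) (hf : IsReward M f) (x : X) :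
    policyValue δ Q x (smallestEquilibrium δ f Q) f ≤ optimalValue δ Q x f :=
  le_iSup₂_of_le _ (isEquilibrium_smallestEquilibrium hδ hM hf) le_rfl

end Equilibria

/-! ### Passage to the limit -/

section Limits

variable {X : Type*} [MeasurableSpace X] {δ : ℕ → ℝ} {M : ℝ}
  {Q : ℕ → Kernel X X} [∀ n, IsMarkovKernel (Q n)] {Qlim : Kernel X X}
  [IsMarkovKernel Qlim] {f : ℕ → X → ℝ} {flim : X → ℝ}

lemma eventually_mem_smallestEquilibrium (hδ : IsDiscount δ) (hM : 0 < M)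
    (hf : ∀ n, IsReward M (f n)) (hflim : IsReward M flim)
    (hQ : ∀ y, Tendsto (fun n => (tvDist (Q n y) (Qlim y)).toReal) atTop (𝓝 0))
    (hfl : ∀ y, Tendsto (fun n => f n y) atTop (𝓝 (flim y)))
    (x : X) (hx : x ∈ smallestEquilibrium δ flim Qlim) :
    ∀ᶠ n in atTop, x ∈ smallestEquilibrium δ (f n) (Q n) := by
  rw [smallestEquilibrium_eq hδ hM hflim] at hx
  obtain ⟨k, hxk⟩ := Set.mem_iUnion.1 hx
  clear hx
  induction k generalizing x with
  | zero => exact absurd hxk (Set.notMem_empty x)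
  | succ k ih =>
    rcases hxk with hxk | hxk
    · exact ih x hxk
    · have hE := fun n => isEquilibrium_smallestEquilibrium (Q := Q n) hδ hM (hf n)
      obtain ⟨c, hc1, hc2⟩ := exists_between (show _ < flim x from hxk)
      -- The induction hypothesis `ih` is exactly the set condition of the semicontinuity lemma,
      -- with the smallest equilibria as `S n` and the iterate as `T`.
      filter_upwards [eventually_integral_snellValue_lt hδ hM hf hflim (fun n => (hE n).1)
        (measurableSet_stoppingIterate hδ hM.le hflim k) hQ hfl ih x hc1,
        (hfl x).eventually (lt_mem_nhds hc2)] with n h1 h2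
      by_contra hn
      exact absurd ((hE n).le_integral_snellValue hδ hM.le (hf n) x hn) (not_le.2 (h1.trans h2))

lemma eventually_policyValue_lt (hδ : IsDiscount δ) (hM : 0 < M)
    (hf : ∀ n, IsReward M (f n)) (hflim : IsReward M flim)
    (hQ : ∀ y, Tendsto (fun n => (tvDist (Q n y) (Qlim y)).toReal) atTop (𝓝 0))
    (hfl : ∀ y, Tendsto (fun n => f n y) atTop (𝓝 (flim y))) (x : X) {c : ℝ}
    (hc : policyValue δ Qlim x (smallestEquilibrium δ flim Qlim) flim < c) :
    ∀ᶠ n in atTop, policyValue δ (Q n) x (smallestEquilibrium δ (f n) (Q n)) (f n) < c := by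
  have hE := fun n => isEquilibrium_smallestEquilibrium (Q := Q n) hδ hM (hf n)
  have hElim := isEquilibrium_smallestEquilibrium (Q := Qlim) hδ hM hflim
  have hev := eventually_mem_smallestEquilibrium hδ hM hf hflim hQ hfl
  unfold policyValue at hc
  by_cases hx : x ∈ smallestEquilibrium δ flim Qlim
  · rw [if_pos hx] at hc
    filter_upwards [hev x hx, (hfl x).eventually (gt_mem_nhds hc)] with n h1 h2
    rwa [policyValue, if_pos h1]
  · rw [if_neg hx] at hc
    -- Here `x` may or may not lie in the perturbed equilibria, so immediate reward and continuation
    -- value must both stay below `c`.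
    have hfc : flim x < c := (hElim.2.1 x hx).trans_lt hc
    rw [hElim.stopValue_eq hδ hM.le hflim] at hc
    filter_upwards [(hfl x).eventually (gt_mem_nhds hfc), eventually_integral_snellValue_lt
      hδ hM hf hflim (fun n => (hE n).1) hElim.1 hQ hfl hev x hc] with n h1 h2
    unfold policyValue
    split
    · exact h1
    · rwa [(hE n).stopValue_eq hδ hM.le (hf n)]

omit [∀ n, IsMarkovKernel (Q n)] [IsMarkovKernel Qlim] in
lemma TendstoLocallyUniformlyTV.tendsto_toReal [TopologicalSpace X]
    (hQ : TendstoLocallyUniformlyTV Q Qlim) (y : X) :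
    Tendsto (fun n => (tvDist (Q n y) (Qlim y)).toReal) atTop (𝓝 0) := by
  have h : Tendsto (fun n => tvDist (Q n y) (Qlim y)) atTop (𝓝 0) := by
    simpa using hQ {y} isCompact_singleton
  exact (ENNReal.tendsto_toReal ENNReal.zero_ne_top).comp h

end Limits

end EquilibriumStopping

theorem theorem1 {X : Type*} [TopologicalSpace X] [PolishSpace X] [MeasurableSpace X]
    [BorelSpace X]
    (δ : ℕ → ℝ) (hδ_mem : ∀ t, δ t ∈ Set.Icc (0 : ℝ) 1) (hδ_anti : Antitone δ)
    (hδ_zero : δ 0 = 1) (hδ_one : δ 1 < 1) (hδ_lim : Tendsto δ atTop (𝓝 0))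
    (hδ_log : ∀ s t, δ t * δ s ≤ δ (t + s))
    (Q : ℕ → Kernel X X) [∀ n, IsMarkovKernel (Q n)]
    (Qlim : Kernel X X) [IsMarkovKernel Qlim]
    (f : ℕ → X → ℝ) (flim : X → ℝ)
    (hf_meas : ∀ n, Measurable (f n)) (hflim_meas : Measurable flim)
    (hf_nonneg : ∀ n x, 0 ≤ f n x) (hflim_nonneg : ∀ x, 0 ≤ flim x)
    (hf_bdd : ∃ M : ℝ, (∀ n x, f n x ≤ M) ∧ ∀ x, flim x ≤ M)
    (hQ : EquilibriumStopping.TendstoLocallyUniformlyTV Q Qlim)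
    (hf : ∀ K : Set X, IsCompact K → TendstoUniformlyOn f flim atTop K) :
    EquilibriumStopping.smallestEquilibrium δ flim Qlim ⊆
        liminf (fun n => EquilibriumStopping.smallestEquilibrium δ (f n) (Q n)) atTop ∧
      ∀ x : X,
        limsup (fun n => EquilibriumStopping.optimalValue δ (Q n) x (f n)) atTop ≤
          EquilibriumStopping.optimalValue δ Qlim x flim := by
  obtain ⟨M₀, hM₀, hM₀'⟩ := hf_bdd
  -- The bound must be strictly positive for the rescaling of test functions.
  have hM : 0 < max M₀ 1 := lt_max_of_lt_right one_pos
  have hδ : EquilibriumStopping.IsDiscount δ :=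
    ⟨fun t => (hδ_mem t).1, fun t => (hδ_mem t).2, hδ_anti, hδ_lim, hδ_log⟩
  have hr : ∀ n, EquilibriumStopping.IsReward (max M₀ 1) (f n) := fun n =>
    ⟨hf_meas n, hf_nonneg n, fun x => (hM₀ n x).trans (le_max_left _ _)⟩
  have hrlim : EquilibriumStopping.IsReward (max M₀ 1) flim :=
    ⟨hflim_meas, hflim_nonneg, fun x => (hM₀' x).trans (le_max_left _ _)⟩
  have hfl : ∀ y, Tendsto (fun n => f n y) atTop (𝓝 (flim y)) := fun y =>
    (hf {y} isCompact_singleton).tendsto_at rfl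
  refine ⟨fun x hx => ?_, fun x => ?_⟩
  · rw [mem_liminf_iff_eventually_mem]
    exact EquilibriumStopping.eventually_mem_smallestEquilibrium hδ hM hr hrlim
      hQ.tendsto_toReal hfl x hx
  · refine le_trans ?_ (EquilibriumStopping.le_optimalValue hδ hM hrlim x)
    refine EReal.le_of_forall_lt_iff_le.1 fun c hc => ?_
    refine limsup_le_of_le (by isBoundedDefault) ?_
    filter_upwards [EquilibriumStopping.eventually_policyValue_lt hδ hM hr hrlim hQ.tendsto_toReal hfl x
      (EReal.coe_lt_coe_iff.1 hc)] with n hn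
    exact (EquilibriumStopping.optimalValue_le hδ hM (hr n) x).trans (EReal.coe_le_coe_iff.2 hn.le)
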